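/- Let $M\subseteq\mathbb Z\times\mathbb Z$ be a finite set of moves (for example the knight moves together with $(0,0)$), and let $w$ be the largest absolute value of a coordinate of an element of $M$ ($w=0$ if $M=\emptyset$). For $q,n\in\mathbb N$ let $f_q(n)$ be the number of placements $(x_1,\dots,x_q)\in([n]^2)^q$ of $q$ labeled pieces such that $x_j-x_i\notin M$ for all $i\ne j$. **Definitions.** Let $g\in\mathbb Q[x]$ be integer-valued on $\mathbb Z$ and eventually nonnegative, $S=\{q\in\mathbb N: g(q)\ge 0\}$. A family of polynomials $F_q\in\mathbb Q[n]$, $q\in\mathbb N$, with $F_q=0$ for $q\notin S$ and, for $q\in S$, $F_q=\sum_{r\ge0}c_r(q)n^{g(q)-r}$ (where $c_r(q)=0$ for $r>g(q)$) is a *two-level polynomial of degree $g$ and infinite depth* if for each $q\in S$ either $\deg F_q=g(q)$ or $F_q=0$, and there are polynomials $\phi_r\in\mathbb Q[x]$ ($r\ge 0$) with $c_r(q)=\phi_r(q)$ for all $q\in S$ and all $r\ge0$. Functions $f_q$ ($q\in\mathbb N$) form an *eventual two-level polynomial of degree $g$ and infinite depth* if $f_q=0$ for $q\notin S$ and, for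 each $q\in S$, $f_q(n)$ agrees for all sufficiently large $n$ with a polynomial $F_q(n)$ of degree exactly $g(q)$, where the coefficients of the $F_q$ satisfy the same condition. The *attack graph* of a placement $x:[q]\to\mathbb Z^2$ has vertices $[q]$ and an edge $i\to j$ labeled $m\in M$ whenever $i\neq j$ and $x_j-x_i=m$. The attack graphs of all placements, ordered by inclusion, form a finite poset $\mathcal L_q$ with least element the empty graph $\hat 0$; write $\mu(G)=\mu_{\mathcal L_q}(\hat 0,G)$. A *crux* $G$ is an attack graph on some vertex set $[k]$ without isolated vertices; let $c$ be its number of connected components, $C_G$ its number of automorphisms (as a labeled directed graph), and $r=2(k-c)$ its *codegree*. For each component, the relative positions of its pieces are determined by $G$; let $\vec a_G\in\mathbb N^{2c}$ list, over all components, the largest difference of the first coordinates and the largest difference of the second coordinates of its pieces. For $\vec a\in\mathbb N^d$ put $g_d(\vec a;n)=(n-a_1)\cdots(n-a_d)$ if $n\ge\max_i a_i$ and $g_d(\vec a;n)=0$ otherwise. Write $(q)_k=q(q-1)\cdots(q-k+1)$. **Theorem.** $f_q(n)$ is an eventual two-level polynomial of degree $2q$ and infinite depth. Furthermore, for each $r$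 there are finitely many isomorphism classes of cruxes of codegree $r$; with representatives $G_{r,1},\dots,G_{r,m_r}$ and with $k_{r,t}$, $c_{r,t}$, $C_{r,t}$, $\vec a_{r,t}$, $\mu_{r,t}$ denoting the data of $G_{r,t}$, for all $q,n\in\mathbb N$ $$f_q(n)=n^{2q}+\sum_{\substack{r\ge2\\ r\text{ even}}}\ \sum_{t=1}^{m_r}\frac{\mu_{r,t}\,(q)_{k_{r,t}}}{C_{r,t}}\,n^{2q-2c_{r,t}-r}\,g_{2c_{r,t}}(\vec a_{r,t};n),$$ where summands with $k_{r,t}>q$ are zero (in particular all those with $r\geq 2q$), and $\max_i(\vec a_{r,t})_i\le wr/2$. For $n\ge wr/2$, each summand of codegree $r$ agrees with $$\frac{\mu_{r,t}(q)_{k_{r,t}}}{C_{r,t}}n^{2q-2c_{r,t}-r}\prod_{i=1}^{2c_{r,t}}\bigl(n-(\vec a_{r,t})_i\bigr),$$ which is a two-level polynomial of degree $2q-r$ and infinite depth (its degree is exactly $2q-r$ whenever $q\ge k_{r,t}$ and $\mu_{r,t}\ne0$). Consequently, for $n\ge wr/2$ the sum over $t$ of all summands of codegree $r$ agrees with a family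 of polynomials of degree at most $2q-r$ (zero if $2q<r$) whose coefficients of $n^{2q-r-s}$ are, for every $s\ge0$ and every $q$ with $2q\ge r$, the values at $q$ of a polynomial depending only on $r$ and $s$. -/

import Mathlib

open Polynomial

/-! ### Two-level polynomials -/

/-- A polynomial in `ℚ[x]` taking integer values at all integers. -/
def IsNumericalPolynomial (g : ℚ[X]) : Prop :=
  ∀ z : ℤ, ∃ m : ℤ, g.eval (z : ℚ) = (m : ℚ)

/-- `g(q) ≥ 0` for all sufficiently large natural numbers `q`. -/
def IsEventuallyNonneg (g : ℚ[X]) : Prop :=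
  ∀ᶠ q : ℕ in Filter.atTop, 0 ≤ g.eval (q : ℚ)

/-- The codegree `r` coefficient of `p` with respect to the degree `d`, i.e. the coefficient of
`x ^ (d - r)`, understood to be `0` when `r > d`. -/
noncomputable def codegreeCoeff (d r : ℕ) (p : ℚ[X]) : ℚ :=
  if r ≤ d then p.coeff (d - r) else 0

/-- There are polynomials `φ r` such that for every `q` with `g(q) ≥ 0` (the natural number `g(q)`
is called `d`) and every `r ≤ e(q)`, the codegree `r` coefficient of `F q`, with respect to the
degree `g(q)`, is `φ r` evaluated at `q`. Depths lie in `ℕ ∪ {-1, ∞}`, with `-1` encoded as `⊥`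
and `∞` as `⊤`. -/
def HasTwoLevelCoefficients (g : ℚ[X]) (e : ℕ → WithBot ℕ∞) (F : ℕ → ℚ[X]) : Prop :=
  ∃ φ : ℕ → ℚ[X], ∀ q d r : ℕ, g.eval (q : ℚ) = (d : ℚ) → ((r : ℕ∞) : WithBot ℕ∞) ≤ e q →
    codegreeCoeff d r (F q) = (φ r).eval (q : ℚ)

/-- Two-level polynomials of degree `g` and depth `e`. As usual for families such as
`q (q - 1) n ^ q`, the polynomial `F q` is allowed to be zero for some `q`. -/
structure IsTwoLevelPolynomial (g : ℚ[X]) (e : ℕ → WithBot ℕ∞) (F : ℕ → ℚ[X]) : Prop where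
  numerical : IsNumericalPolynomial g
  eventuallyNonneg : IsEventuallyNonneg g
  degree_eq : ∀ q d : ℕ, g.eval (q : ℚ) = (d : ℚ) → F q = 0 ∨ (F q).degree = (d : WithBot ℕ)
  eq_zero : ∀ q : ℕ, g.eval (q : ℚ) < 0 → F q = 0
  coefficients : HasTwoLevelCoefficients g e F

/-- Eventual two-level polynomials of degree `g` and depth `e`: sequences of functions `f q` that
agree, for sufficiently large `n`, with polynomials `F q` of degree exactly `g(q)` whose codegree
`r` coefficients are polynomial in `q` for `r ≤ e(q)`. -/
def IsEventualTwoLevelPolynomial (g : ℚ[X]) (e : ℕ → WithBot ℕ∞) (f : ℕ → ℕ → ℚ) : Prop :=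
  IsNumericalPolynomial g ∧ IsEventuallyNonneg g ∧
    (∀ q : ℕ, g.eval (q : ℚ) < 0 → ∀ n : ℕ, f q n = 0) ∧
    ∃ F : ℕ → ℚ[X],
      (∀ q d : ℕ, g.eval (q : ℚ) = (d : ℚ) → (F q).degree = (d : WithBot ℕ) ∧
        ∀ᶠ n : ℕ in Filter.atTop, f q n = (F q).eval (n : ℚ)) ∧
      HasTwoLevelCoefficients g e F

/-! ### Nonattacking placements -/

/-- The number of placements of `q` labeled pieces on the squares `{1, …, n}²` such that no piece
attacks another one. -/
noncomputable def nonattackingCount (M : Finset (ℤ × ℤ)) (q n : ℕ) : ℕ :=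
  ((Fintype.piFinset fun _ : Fin q => Finset.Icc (1 : ℤ) n ×ˢ Finset.Icc (1 : ℤ) n).filter
    fun x => ∀ i j, i ≠ j → x j - x i ∉ M).card

/-- The largest absolute value of a coordinate of a move (`0` if there are no moves). -/
def maxCoord (M : Finset (ℤ × ℤ)) : ℕ :=
  M.sup fun m => max m.1.natAbs m.2.natAbs

/-! ### Attack graphs -/

/-- The attack graph of a placement: the set of labeled edges `(i, j, m)` such that piece `i`
attacks piece `j ≠ i` by the move `m`. -/
def attackEdges (M : Finset (ℤ × ℤ)) {q : ℕ} (x : Fin q → ℤ × ℤ) :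
    Finset (Fin q × Fin q × (ℤ × ℤ)) :=
  (Finset.univ ×ˢ Finset.univ ×ˢ M).filter fun e => e.1 ≠ e.2.1 ∧ x e.2.1 - x e.1 = e.2.2

/-- The attack graphs on `q` pieces that are realized by some placement, ordered by inclusion. -/
abbrev AttackGraph (M : Finset (ℤ × ℤ)) (q : ℕ) : Type :=
  {G : Finset (Fin q × Fin q × (ℤ × ℤ)) // ∃ x : Fin q → ℤ × ℤ, attackEdges M x = G}

theorem attackGraph_finite (M : Finset (ℤ × ℤ)) (q : ℕ) : Finite (AttackGraph M q) := by
  have h : {G : Finset (Fin q × Fin q × (ℤ × ℤ)) |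
      ∃ x : Fin q → ℤ × ℤ, attackEdges M x = G}.Finite := by
    refine Set.Finite.subset
      (Finset.finite_toSet (Finset.univ ×ˢ Finset.univ ×ˢ M).powerset) ?_
    rintro G ⟨x, rfl⟩
    simp only [Finset.coe_powerset, Set.mem_preimage, Set.mem_powerset_iff, Finset.coe_subset]
    exact Finset.filter_subset _ _
  exact h.to_subtype

noncomputable instance attackGraphLocallyFinite (M : Finset (ℤ × ℤ)) (q : ℕ) :
    LocallyFiniteOrder (AttackGraph M q) := by
  classical
  haveI := attackGraph_finite M q
  haveI := Fintype.ofFinite (AttackGraph M q)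
  exact Fintype.toLocallyFiniteOrder

/-- The empty graph is an attack graph: put the pieces far apart. -/
theorem exists_attackEdges_eq_empty (M : Finset (ℤ × ℤ)) (q : ℕ) :
    ∃ x : Fin q → ℤ × ℤ, attackEdges M x = ∅ := by
  refine ⟨fun i => ((i : ℤ) * (maxCoord M + 1), 0), ?_⟩
  refine Finset.filter_eq_empty_iff.2 ?_
  rintro ⟨i, j, m⟩ he ⟨hij, hm⟩
  simp only [Finset.mem_product, Finset.mem_univ, true_and] at he hij hm
  have h1 : m.1.natAbs ≤ maxCoord M :=
    le_trans (le_max_left _ _) (Finset.le_sup (f := fun m : ℤ × ℤ => max m.1.natAbs m.2.natAbs) he)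
  rw [← hm] at h1
  have h2 : ((j : ℤ) - (i : ℤ)).natAbs * (maxCoord M + 1) ≤ maxCoord M := by
    have : ((j : ℤ) * (maxCoord M + 1) - (i : ℤ) * (maxCoord M + 1)).natAbs
        = ((j : ℤ) - (i : ℤ)).natAbs * (maxCoord M + 1) := by
      rw [← sub_mul, Int.natAbs_mul]
      congr 1
    rw [← this]
    exact h1
  have h3 : 1 ≤ ((j : ℤ) - (i : ℤ)).natAbs := by
    have : (i : ℕ) ≠ (j : ℕ) := fun h => hij (Fin.ext h)
    omega
  nlinarith

/-- The empty attack graph. -/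
def AttackGraph.empty (M : Finset (ℤ × ℤ)) (q : ℕ) : AttackGraph M q :=
  ⟨∅, exists_attackEdges_eq_empty M q⟩

open Classical in
/-- The Möbius number `μ([∅, G])` of an attack graph in the poset of attack graphs. -/
noncomputable def AttackGraph.mobius {M : Finset (ℤ × ℤ)} {q : ℕ} (G : AttackGraph M q) : ℤ :=
  IncidenceAlgebra.mu ℤ (AttackGraph.empty M q) G

/-! ### Cruxes and the terms of the formula -/

/-- A crux: an attack graph, on some number of pieces, without isolated vertices. -/
structure Crux (M : Finset (ℤ × ℤ)) where
  size : ℕ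
  graph : AttackGraph M size
  no_isolated : ∀ i, ∃ j m, (i, j, m) ∈ graph.1 ∨ (j, i, m) ∈ graph.1

namespace Crux

variable {M : Finset (ℤ × ℤ)}

/-- Isomorphism of labeled directed graphs. -/
def Iso (G H : Crux M) : Prop :=
  ∃ σ : Fin G.size ≃ Fin H.size, ∀ i j m, (i, j, m) ∈ G.graph.1 ↔ (σ i, σ j, m) ∈ H.graph.1

/-- The number of automorphisms of a crux. -/
noncomputable def autCard (G : Crux M) : ℕ :=
  Nat.card {σ : Equiv.Perm (Fin G.size) //
    ∀ i j m, (i, j, m) ∈ G.graph.1 ↔ (σ i, σ j, m) ∈ G.graph.1}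

/-- The underlying simple undirected graph. -/
def toSimpleGraph (G : Crux M) : SimpleGraph (Fin G.size) :=
  SimpleGraph.fromRel fun i j => ∃ m, (i, j, m) ∈ G.graph.1

/-- The connected components; all of them have at least two vertices. -/
abbrev Component (G : Crux M) : Type := G.toSimpleGraph.ConnectedComponent

noncomputable instance (G : Crux M) : Fintype G.Component :=
  Fintype.ofFinite _

/-- The number `c` of connected components. -/
noncomputable def numComponents (G : Crux M) : ℕ := Fintype.card G.Component

/-- The codegree `r = 2 (k - c)`, where `k` is the number of vertices. -/
noncomputable def codegree (G : Crux M) : ℕ := 2 * (G.size - G.numComponents)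

/-- A placement with attack graph `G`. It determines the relative positions of two pieces in the
same component, which do not depend on its choice. -/
noncomputable def position (G : Crux M) : Fin G.size → ℤ × ℤ := Classical.choose G.graph.2

open Classical in
/-- The largest difference of first coordinates within a component. -/
noncomputable def width (G : Crux M) (K : G.Component) : ℕ :=
  Finset.univ.sup fun p : K.supp × K.supp => ((G.position p.1).1 - (G.position p.2).1).toNat

open Classical in
/-- The largest difference of second coordinates within a component. -/
noncomputable def height (G : Crux M) (K : G.Component) : ℕ :=
  Finset.univ.sup fun p : K.supp × K.supp => ((G.position p.1).2 - (G.position p.2).2).toNat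

/-- The vector of length `2c` of the widths and heights of all components. -/
noncomputable def extents (G : Crux M) : G.Component ⊕ G.Component → ℕ :=
  Sum.elim G.width G.height

/-- The factor `μ(G) * (q)_k / |Aut G|`; here `(q)_k / |Aut G|` is the number of copies of `G`
inside `{1, …, q}`. -/
noncomputable def coeff (G : Crux M) (q : ℕ) : ℚ :=
  (G.graph.mobius : ℚ) * (q.descFactorial G.size : ℚ) / (G.autCard : ℚ)

end Crux

/-- The function `g_d(a; n)`. -/
noncomputable def truncatedProd {ι : Type*} [Fintype ι] (a : ι → ℕ) (n : ℕ) : ℚ :=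
  open Classical in if ∀ i, a i ≤ n then ∏ i, ((n : ℚ) - (a i : ℚ)) else 0

namespace Crux

variable {M : Finset (ℤ × ℤ)}

/-- The term of the formula for the nonattacking count contributed by all copies of `G`. The
exponent is `2 (q - k)`; when it would be negative, the coefficient vanishes. -/
noncomputable def term (G : Crux M) (q n : ℕ) : ℚ :=
  G.coeff q * (n : ℚ) ^ (2 * q - 2 * G.numComponents - G.codegree) * truncatedProd G.extents n

/-- The polynomial obtained from `term` by dropping the truncation. -/
noncomputable def termPoly (G : Crux M) (q : ℕ) : ℚ[X] :=
  C (G.coeff q) * X ^ (2 * q - 2 * G.numComponents - G.codegree) *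
    ∏ i, (X - C ((G.extents i : ℕ) : ℚ))

end Crux

/-! ### Relabeling the pieces of attack graphs -/

/-! For a fixed placement, the sum of `μ` over all attack graphs contained in its own is 1 if the
placement is nonattacking and 0 otherwise. Hence `f_q(n)` is the sum over attack graphs `A` on `[q]`
of `μ(A)` times the number of placements whose attack graph contains `A`
(`nonattackingCount_eq_sum_mobius`).

Isolated vertices of `A` are free: each multiplies the count by `n²` (`AttackGraph.superCount_map`)
and none affects `μ` (`AttackGraph.mobius_map`). What remains is a crux `G`. A placement contains
`G` exactly when it is a translate of one fixed placement on each component, the translations being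
independent, so the count is a product of truncated factors `n - aᵢ` (`Crux.superCount_eq`).
Grouping the `A` by the isomorphism type of their crux gives the formula: there are `(q)_k`
injections `[k] → [q]`, and each copy of `G` arises from `|Aut G|` of them (`Crux.term_eq_sum`).

Components have at least two vertices, so `k ≤ r` and each codegree has finitely many cruxes. A path
in a component has at most `k - c = r/2` edges, which bounds the extents by `wr/2`. Beyond that
bound a term is `(q)_k n^(2(q-k)) ∏ (n - aᵢ)` times a constant, so its coefficient at a given
codegree is a constant times `(q)_k`. Codegree `s` of the whole count involves only cruxes of
codegree at most `s`, finitely many types; those with `r > 2q` drop out by themselves because `(q)_k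
= 0`. -/

theorem mem_attackEdges {M : Finset (ℤ × ℤ)} {q : ℕ} {x : Fin q → ℤ × ℤ} {i j : Fin q}
    {m : ℤ × ℤ} : (i, j, m) ∈ attackEdges M x ↔ m ∈ M ∧ i ≠ j ∧ x j - x i = m := by
  simp [attackEdges]

theorem natAbs_le_maxCoord {M : Finset (ℤ × ℤ)} {m : ℤ × ℤ} (hm : m ∈ M) :
    m.1.natAbs ≤ maxCoord M ∧ m.2.natAbs ≤ maxCoord M :=
  max_le_iff.1 (Finset.le_sup (f := fun m : ℤ × ℤ => max m.1.natAbs m.2.natAbs) hm)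

/-- The action of an injection of the pieces on labeled edges. -/
def edgeEmbedding {k q : ℕ} (ε : Fin k ↪ Fin q) :
    Fin k × Fin k × (ℤ × ℤ) ↪ Fin q × Fin q × (ℤ × ℤ) :=
  ε.prodMap (ε.prodMap (Function.Embedding.refl _))

@[simp]
theorem edgeEmbedding_apply {k q : ℕ} (ε : Fin k ↪ Fin q) (e : Fin k × Fin k × (ℤ × ℤ)) :
    edgeEmbedding ε e = (ε e.1, ε e.2.1, e.2.2) := rfl

/-- Every placement of `k` pieces extends along an injection to a placement of `q` pieces without
new attacks. -/
theorem exists_attackEdges_eq_map (M : Finset (ℤ × ℤ)) {k q : ℕ} (ε : Fin k ↪ Fin q)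
    (p : Fin k → ℤ × ℤ) :
    ∃ x : Fin q → ℤ × ℤ, attackEdges M x = (attackEdges M p).map (edgeEmbedding ε) := by
  classical
  set P : ℕ := Finset.univ.sup fun i => (p i).1.natAbs with hP
  have hp : ∀ i, (p i).1.natAbs ≤ P := fun i =>
    Finset.le_sup (f := fun i => (p i).1.natAbs) (Finset.mem_univ i)
  -- New pieces sit at multiples `(v + 1) B` of the spacing. They differ from each other by at least
  -- `B` and from old pieces by at least `B - P`, and both exceed `maxCoord M`.
  set B : ℕ := P + maxCoord M + 1 with hB
  set far : Fin q → ℤ × ℤ := fun v => (((v : ℕ) + 1 : ℤ) * B, 0) with hfar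
  have hx : ∀ v, (¬ ∃ i, ε i = v) → Function.extend ε p far v = far v := fun v hv =>
    Function.extend_apply' _ _ _ hv
  have hx' : ∀ i, Function.extend ε p far (ε i) = p i := ε.injective.extend_apply _ _
  refine ⟨Function.extend ε p far, ?_⟩
  ext ⟨i, j, m⟩
  rw [mem_attackEdges]
  constructor
  · rintro ⟨hm, hij, hd⟩
    have hw := (natAbs_le_maxCoord hm).1
    rw [← hd] at hw
    by_cases hi : ∃ a, ε a = i <;> by_cases hj : ∃ b, ε b = j
    · obtain ⟨a, rfl⟩ := hi
      obtain ⟨b, rfl⟩ := hj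
      refine Finset.mem_map.2 ⟨(a, b, m), mem_attackEdges.2 ⟨hm, ?_, ?_⟩, rfl⟩
      · rintro rfl; exact hij rfl
      · rw [← hx' a, ← hx' b, hd]
    · exfalso
      obtain ⟨a, rfl⟩ := hi
      rw [hx _ hj, hx'] at hw
      have := hp a
      have h2 : (1 : ℤ) * B ≤ ((j : ℕ) + 1 : ℤ) * B := by gcongr; omega
      simp only [hfar, Prod.fst_sub] at hw
      omega
    · exfalso
      obtain ⟨a, rfl⟩ := hj
      rw [hx _ hi, hx'] at hw
      have := hp a
      have h2 : (1 : ℤ) * B ≤ ((i : ℕ) + 1 : ℤ) * B := by gcongr; omega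
      simp only [hfar, Prod.fst_sub] at hw
      omega
    · exfalso
      rw [hx _ hi, hx _ hj] at hw
      have h1 : ((far j - far i).1).natAbs = (((j : ℕ) : ℤ) - (i : ℕ)).natAbs * B := by
        simp only [hfar, Prod.fst_sub]
        rw [← sub_mul, Int.natAbs_mul, Int.natAbs_natCast]
        congr 2
        ring
      have h2 : 1 ≤ (((j : ℕ) : ℤ) - (i : ℕ)).natAbs := by
        have : (i : ℕ) ≠ (j : ℕ) := fun h => hij (Fin.ext h)
        omega
      rw [h1] at hw
      have := Nat.mul_le_mul_right B h2
      omega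
  · intro h
    obtain ⟨⟨a, b, m'⟩, hab, he⟩ := Finset.mem_map.1 h
    simp only [edgeEmbedding_apply, Prod.mk.injEq] at he
    obtain ⟨rfl, rfl, rfl⟩ := he
    rw [mem_attackEdges] at hab
    exact ⟨hab.1, ε.injective.ne hab.2.1, by rw [hx', hx', hab.2.2]⟩

theorem attackEdges_comp {M : Finset (ℤ × ℤ)} {k q : ℕ} (ε : Fin k ↪ Fin q)
    (x : Fin q → ℤ × ℤ) :
    attackEdges M (x ∘ ε) =
      (attackEdges M x).preimage (edgeEmbedding ε) (edgeEmbedding ε).injective.injOn := by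
  ext ⟨i, j, m⟩
  simp [mem_attackEdges]

/-! ### Images and restrictions of attack graphs; invariance of the Möbius number -/

namespace AttackGraph

variable {M : Finset (ℤ × ℤ)} {k q : ℕ}

/-- The image of an attack graph under an injection of the pieces; the new pieces are isolated. -/
def map (ε : Fin k ↪ Fin q) (G : AttackGraph M k) : AttackGraph M q :=
  ⟨G.1.map (edgeEmbedding ε), by
    obtain ⟨p, hp⟩ := G.2
    obtain ⟨x, hx⟩ := exists_attackEdges_eq_map M ε p
    exact ⟨x, by rw [hx, hp]⟩⟩

/-- The restriction of an attack graph along an injection of the pieces. -/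
noncomputable def comap (ε : Fin k ↪ Fin q) (G : AttackGraph M q) : AttackGraph M k :=
  ⟨G.1.preimage (edgeEmbedding ε) (edgeEmbedding ε).injective.injOn, by
    obtain ⟨x, hx⟩ := G.2
    exact ⟨x ∘ ε, by rw [attackEdges_comp, hx]⟩⟩

theorem mem_map {ε : Fin k ↪ Fin q} {G : AttackGraph M k} {e : Fin q × Fin q × (ℤ × ℤ)} :
    e ∈ (G.map ε).1 ↔ ∃ e' ∈ G.1, edgeEmbedding ε e' = e :=
  Finset.mem_map

theorem mem_comap {ε : Fin k ↪ Fin q} {G : AttackGraph M q} {e : Fin k × Fin k × (ℤ × ℤ)} :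
    e ∈ (G.comap ε).1 ↔ edgeEmbedding ε e ∈ G.1 :=
  Finset.mem_preimage (hf := (edgeEmbedding ε).injective.injOn)

theorem apply_mem_map {ε : Fin k ↪ Fin q} {G : AttackGraph M k} {i j : Fin k} {m : ℤ × ℤ} :
    (ε i, ε j, m) ∈ (G.map ε).1 ↔ (i, j, m) ∈ G.1 :=
  Finset.mem_map' (edgeEmbedding ε) (a := (i, j, m))

theorem map_le_map_iff {ε : Fin k ↪ Fin q} {G H : AttackGraph M k} :
    G.map ε ≤ H.map ε ↔ G ≤ H :=
  Finset.map_subset_map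

theorem map_injective (ε : Fin k ↪ Fin q) : Function.Injective (map (M := M) ε) := fun _ _ h =>
  le_antisymm (map_le_map_iff.1 h.le) (map_le_map_iff.1 h.ge)

theorem map_comap {ε : Fin k ↪ Fin q} {G : AttackGraph M q}
    (h : ∀ e ∈ G.1, e ∈ Set.range (edgeEmbedding ε)) : (G.comap ε).map ε = G := by
  apply Subtype.ext
  ext e
  rw [mem_map]
  constructor
  · rintro ⟨e', he', rfl⟩
    exact mem_comap.1 he'
  · intro he
    obtain ⟨e', rfl⟩ := h e he
    exact ⟨e', mem_comap.2 he, rfl⟩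

/-- Edges of a subgraph of an image lie over the range of `ε`. So `map ε` identifies the interval
below `H` with the interval below its image, which is what Möbius numbers need. -/
theorem map_comap_of_le {ε : Fin k ↪ Fin q} {G : AttackGraph M q} {H : AttackGraph M k}
    (h : G ≤ H.map ε) : (G.comap ε).map ε = G :=
  map_comap fun e he => by
    obtain ⟨e', -, rfl⟩ := mem_map.1 (h he)
    exact ⟨e', rfl⟩

theorem map_empty (ε : Fin k ↪ Fin q) : (empty M k).map ε = empty M q :=
  Subtype.ext (Finset.map_empty _)

theorem empty_le (G : AttackGraph M q) : empty M q ≤ G := Finset.empty_subset _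

theorem mobius_empty : (empty M q).mobius = 1 := by
  rw [mobius, IncidenceAlgebra.mu_self]

theorem mobius_of_ne {G : AttackGraph M q} (h : G ≠ empty M q) :
    G.mobius = -∑ H ∈ Finset.Ico (empty M q) G, H.mobius := by
  rw [mobius, IncidenceAlgebra.mu_eq_neg_sum_Ico_of_ne h.symm]
  rfl

theorem sum_mobius_Icc (G : AttackGraph M q) [Decidable (G = empty M q)] :
    ∑ H ∈ Finset.Icc (empty M q) G, H.mobius = if G = empty M q then 1 else 0 := by
  classical
  refine (IncidenceAlgebra.sum_Icc_mu_right (𝕜 := ℤ) (empty M q) G).trans ?_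
  simp only [eq_comm]

/-- Isolated pieces do not matter for the Möbius number. -/
theorem mobius_map (ε : Fin k ↪ Fin q) (G : AttackGraph M k) : (G.map ε).mobius = G.mobius := by
  have := attackGraph_finite M k
  induction G using WellFoundedLT.induction with
  | ind G ih =>
    by_cases hG : G = empty M k
    · rw [hG, map_empty, mobius_empty, mobius_empty]
    · have hG' : G.map ε ≠ empty M q := by
        rw [← map_empty ε]
        exact (map_injective ε).ne hG
      rw [mobius_of_ne hG, mobius_of_ne hG', neg_inj]
      symm
      refine Finset.sum_bij (fun H _ => H.map ε) ?_ (fun _ _ _ _ h => map_injective ε h) ?_ ?_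
      · intro H hH
        rw [Finset.mem_Ico] at hH ⊢
        refine ⟨empty_le _, lt_of_le_of_ne (map_le_map_iff.2 hH.2.le) ?_⟩
        exact (map_injective ε).ne hH.2.ne
      · intro H hH
        rw [Finset.mem_Ico] at hH
        have h := map_comap_of_le hH.2.le
        refine ⟨H.comap ε, Finset.mem_Ico.2 ⟨empty_le _, lt_of_le_of_ne ?_ ?_⟩, h⟩
        · rw [← map_le_map_iff (ε := ε), h]
          exact hH.2.le
        · intro h'
          rw [h'] at h
          exact hH.2.ne h.symm
      · intro H hH
        exact (ih H (Finset.mem_Ico.1 hH).2).symm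

end AttackGraph

/-! ### Counting placements whose attack graph contains a given one -/

/-- The number of placements on `{1, …, n}²` whose attack graph contains `G`. -/
noncomputable def AttackGraph.superCount {M : Finset (ℤ × ℤ)} {q : ℕ} (G : AttackGraph M q)
    (n : ℕ) : ℕ :=
  ((Fintype.piFinset fun _ : Fin q => Finset.Icc (1 : ℤ) n ×ˢ Finset.Icc (1 : ℤ) n).filter
    fun x => G.1 ⊆ attackEdges M x).card

theorem attackEdges_eq_empty_iff {M : Finset (ℤ × ℤ)} {q : ℕ} {x : Fin q → ℤ × ℤ} :
    attackEdges M x = ∅ ↔ ∀ i j, i ≠ j → x j - x i ∉ M := by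
  rw [Finset.eq_empty_iff_forall_notMem]
  constructor
  · intro h i j hij hm
    exact h (i, j, x j - x i) (mem_attackEdges.2 ⟨hm, hij, rfl⟩)
  · rintro h ⟨i, j, m⟩ he
    obtain ⟨hm, hij, hd⟩ := mem_attackEdges.1 he
    exact h i j hij (hd ▸ hm)

/-- Möbius inversion over the poset of attack graphs. -/
theorem nonattackingCount_eq_sum_mobius (M : Finset (ℤ × ℤ)) (q n : ℕ)
    [Fintype (AttackGraph M q)] :
    (nonattackingCount M q n : ℤ) = ∑ G : AttackGraph M q, G.mobius * G.superCount n := by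
  classical
  simp only [AttackGraph.superCount, nonattackingCount, Finset.card_filter, Nat.cast_sum,
    Finset.mul_sum]
  -- With the placement `x` outermost, the inner sum runs over the interval from the empty graph to
  -- the attack graph of `x`.
  rw [Finset.sum_comm]
  refine Finset.sum_congr rfl fun x _ => ?_
  set A : AttackGraph M q := ⟨attackEdges M x, x, rfl⟩ with hA
  have h1 := A.sum_mobius_Icc
  have h2 : Finset.Icc (AttackGraph.empty M q) A =
      Finset.univ.filter fun G : AttackGraph M q => G.1 ⊆ attackEdges M x := by
    ext G
    simp only [Finset.mem_Icc, AttackGraph.empty_le, true_and, Finset.mem_filter,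
      Finset.mem_univ]
    rfl
  rw [h2, Finset.sum_filter] at h1
  have h3 : A = AttackGraph.empty M q ↔ ∀ i j, i ≠ j → x j - x i ∉ M := by
    rw [← attackEdges_eq_empty_iff, hA, AttackGraph.empty, Subtype.mk.injEq]
  simp only [h3] at h1
  push_cast
  rw [← h1]
  refine Finset.sum_congr rfl fun G _ => ?_
  split_ifs <;> simp

theorem AttackGraph.map_subset_attackEdges_iff {M : Finset (ℤ × ℤ)} {k q : ℕ} (ε : Fin k ↪ Fin q)
    (G : AttackGraph M k) (x : Fin q → ℤ × ℤ) :
    (G.map ε).1 ⊆ attackEdges M x ↔ G.1 ⊆ attackEdges M (x ∘ ε) := by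
  rw [attackEdges_comp, ← Finset.map_subset_iff_subset_preimage]
  rfl

/-- Every isolated piece contributes a factor `n ^ 2`. -/
theorem AttackGraph.superCount_map {M : Finset (ℤ × ℤ)} {k q : ℕ} (ε : Fin k ↪ Fin q)
    (G : AttackGraph M k) (n : ℕ) :
    (G.map ε).superCount n = G.superCount n * n ^ (2 * (q - k)) := by
  classical
  rw [superCount, superCount, Finset.card_eq_sum_card_fiberwise (f := fun x => x ∘ ε)
    (t := (Fintype.piFinset fun _ : Fin k => Finset.Icc (1 : ℤ) n ×ˢ Finset.Icc (1 : ℤ) n).filter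
      fun y => G.1 ⊆ attackEdges M y)]
  -- All fibers of the restriction have the same size: pieces in the range of `ε` are prescribed,
  -- and the other `q - k` range over all `n²` squares.
  · rw [Finset.sum_const_nat (m := n ^ (2 * (q - k)))]
    intro y hy
    rw [Finset.mem_filter, Fintype.mem_piFinset] at hy
    have hfib : {x ∈ (Fintype.piFinset fun _ : Fin q =>
          Finset.Icc (1 : ℤ) n ×ˢ Finset.Icc (1 : ℤ) n).filter
            fun x => (G.map ε).1 ⊆ attackEdges M x | x ∘ ε = y} =
        Fintype.piFinset fun v => if h : ∃ i, ε i = v then {y h.choose} else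
          Finset.Icc (1 : ℤ) n ×ˢ Finset.Icc (1 : ℤ) n := by
      ext x
      simp only [Finset.mem_filter, Fintype.mem_piFinset]
      constructor
      · rintro ⟨⟨hx, -⟩, rfl⟩ v
        split_ifs with h
        · simp [h.choose_spec]
        · exact hx v
      · intro hx
        have hxy : x ∘ ε = y := by
          funext i
          have h : ∃ j, ε j = ε i := ⟨i, rfl⟩
          have := hx (ε i)
          rw [dif_pos h, Finset.mem_singleton, ε.injective h.choose_spec] at this
          exact this
        refine ⟨⟨fun v => ?_, ?_⟩, hxy⟩
        · by_cases h : ∃ i, ε i = v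
          · obtain ⟨i, rfl⟩ := h
            rw [← Function.comp_apply (f := x), hxy]
            exact hy.1 i
          · simpa [h] using hx v
        · rw [map_subset_attackEdges_iff, hxy]
          exact hy.2
    rw [hfib, Fintype.card_piFinset]
    have hcard : ∀ v, (if h : ∃ i, ε i = v then ({y h.choose} : Finset (ℤ × ℤ)) else
        Finset.Icc (1 : ℤ) n ×ˢ Finset.Icc (1 : ℤ) n).card =
          if v ∈ Finset.univ.map ε then 1 else n ^ 2 := by
      intro v
      have : v ∈ Finset.univ.map ε ↔ ∃ i, ε i = v := by simp
      simp only [this]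
      split_ifs
      · simp
      · simp [sq]
    simp only [hcard]
    rw [Finset.prod_ite, Finset.prod_const_one, one_mul, Finset.prod_const, ← pow_mul]
    congr 2
    rw [← Finset.compl_filter, Finset.card_compl]
    simp [Finset.card_image_of_injective _ ε.injective]
  · intro x hx
    simp only [Finset.coe_filter, Fintype.mem_piFinset, Set.mem_ofPred_eq] at hx ⊢
    exact ⟨fun i => hx.1 _, (map_subset_attackEdges_iff ε G x).1 hx.2⟩

/-- The number of translates of a nonempty finite set of integers inside `{1, …, n}`. -/
theorem exists_finset_translates {ι : Type*} [Fintype ι] [Nonempty ι] (a : ι → ℤ) (n : ℕ) :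
    ∃ S : Finset ℤ, (∀ z, z ∈ S ↔ ∀ i, a i + z ∈ Finset.Icc (1 : ℤ) n) ∧
      S.card = n - Finset.univ.sup fun p : ι × ι => (a p.1 - a p.2).toNat := by
  obtain ⟨i₀, hi₀⟩ := Finite.exists_min a
  obtain ⟨i₁, hi₁⟩ := Finite.exists_max a
  -- Only the minimum `a i₀` and the maximum `a i₁` constrain the translation.
  refine ⟨Finset.Icc (1 - a i₀) (n - a i₁), fun z => ?_, ?_⟩
  · simp only [Finset.mem_Icc]
    constructor
    · intro h i
      have := hi₀ i
      have := hi₁ i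
      omega
    · intro h
      have := h i₀
      have := h i₁
      omega
  · have hsup : (Finset.univ.sup fun p : ι × ι => (a p.1 - a p.2).toNat) =
        (a i₁ - a i₀).toNat := by
      refine le_antisymm (Finset.sup_le fun p _ => ?_)
        (Finset.le_sup (f := fun p : ι × ι => (a p.1 - a p.2).toNat)
          (Finset.mem_univ (i₁, i₀)))
      have := hi₁ p.1
      have := hi₀ p.2
      omega
    rw [hsup, Int.card_Icc]
    have := hi₀ i₁
    omega

/-- If some `a i > n`, truncated subtraction already makes one factor zero, matching the cutoff. -/
theorem truncatedProd_eq_prod_sub {ι : Type*} [Fintype ι] (a : ι → ℕ) (n : ℕ) :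
    truncatedProd a n = ((∏ i, (n - a i) : ℕ) : ℚ) := by
  rw [truncatedProd]
  split_ifs with h
  · push_cast
    exact Finset.prod_congr rfl fun i _ => by rw [Nat.cast_sub (h i)]
  · push Not at h
    obtain ⟨i, hi⟩ := h
    rw [Finset.prod_eq_zero (Finset.mem_univ i) (Nat.sub_eq_zero_of_le hi.le), Nat.cast_zero]

/-! ### Translates of a crux; bounds on its size and extents -/

namespace Crux

variable {M : Finset (ℤ × ℤ)} (G : Crux M)

theorem attackEdges_position : attackEdges M G.position = G.graph.1 :=
  Classical.choose_spec G.graph.2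

theorem adj_iff {i j : Fin G.size} :
    G.toSimpleGraph.Adj i j ↔ ∃ m, (i, j, m) ∈ G.graph.1 ∨ (j, i, m) ∈ G.graph.1 := by
  have : ∀ {i j m}, (i, j, m) ∈ G.graph.1 → i ≠ j := by
    intro i j m h
    rw [← attackEdges_position] at h
    exact (mem_attackEdges.1 h).2.1
  rw [toSimpleGraph, SimpleGraph.fromRel_adj]
  constructor
  · rintro ⟨-, ⟨m, h⟩ | ⟨m, h⟩⟩
    exacts [⟨m, .inl h⟩, ⟨m, .inr h⟩]
  · rintro ⟨m, h | h⟩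
    exacts [⟨this h, .inl ⟨m, h⟩⟩, ⟨(this h).symm, .inr ⟨m, h⟩⟩]

/-- An edge prescribes the difference of its endpoints, so `y` has that edge when `y - G.position`
agrees at both ends; walks propagate this over a component. -/
theorem subset_attackEdges_iff (y : Fin G.size → ℤ × ℤ) :
    G.graph.1 ⊆ attackEdges M y ↔
      ∀ i j, G.toSimpleGraph.connectedComponentMk i = G.toSimpleGraph.connectedComponentMk j →
        y i - G.position i = y j - G.position j := by
  constructor
  · intro h
    have hedge : ∀ {i j m}, (i, j, m) ∈ G.graph.1 →
        y i - G.position i = y j - G.position j := by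
      intro i j m he
      have h1 := (mem_attackEdges.1 (h he)).2.2
      rw [← attackEdges_position] at he
      have h2 := (mem_attackEdges.1 he).2.2
      rw [sub_eq_sub_iff_sub_eq_sub, ← neg_sub, h1, ← h2, neg_sub]
    intro i j hij
    obtain ⟨p⟩ := SimpleGraph.ConnectedComponent.eq.1 hij
    clear hij
    induction p with
    | nil => rfl
    | cons hadj _ ih =>
      rw [← ih]
      obtain ⟨m, hm | hm⟩ := G.adj_iff.1 hadj
      exacts [hedge hm, (hedge hm).symm]
  · rintro h ⟨i, j, m⟩ he
    have hadj : G.toSimpleGraph.Adj i j := G.adj_iff.2 ⟨m, .inl he⟩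
    have h1 := h i j (SimpleGraph.ConnectedComponent.eq.2 hadj.reachable)
    rw [← attackEdges_position] at he
    obtain ⟨hm, hij, hd⟩ := mem_attackEdges.1 he
    refine mem_attackEdges.2 ⟨hm, hij, ?_⟩
    rw [sub_eq_sub_iff_sub_eq_sub, ← neg_sub, ← neg_sub (G.position j), neg_inj] at h1
    rw [h1, hd]

/-- A placement containing the attacks of `G` is a translate of `G.position` on each component. -/
theorem superCount_eq (n : ℕ) : G.graph.superCount n = ∏ i, (n - G.extents i) := by
  classical
  have hne : ∀ K : G.Component, Nonempty K.supp := fun K => K.nonempty_supp.to_subtype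
  choose S₁ hS₁ hS₁' using fun K : G.Component =>
    exists_finset_translates (fun i : K.supp => (G.position i).1) n
  choose S₂ hS₂ hS₂' using fun K : G.Component =>
    exists_finset_translates (fun i : K.supp => (G.position i).2) n
  have hprod : ∏ i, (n - G.extents i) = (Fintype.piFinset fun K => S₁ K ×ˢ S₂ K).card := by
    rw [Fintype.card_piFinset, Fintype.prod_sum_type, ← Finset.prod_mul_distrib]
    refine Finset.prod_congr rfl fun K _ => ?_
    rw [Finset.card_product, hS₁', hS₂']
    simp only [extents, Sum.elim_inl, Sum.elim_inr, width, height]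
  rw [hprod, AttackGraph.superCount]
  symm
  refine Finset.card_bij
    (fun z _ i => G.position i + z (G.toSimpleGraph.connectedComponentMk i)) ?_ ?_ ?_
  · intro z hz
    rw [Fintype.mem_piFinset] at hz
    rw [Finset.mem_filter, Fintype.mem_piFinset, subset_attackEdges_iff]
    refine ⟨fun i => ?_, fun i j hij => by simp [hij]⟩
    have hi := Finset.mem_product.1 (hz (G.toSimpleGraph.connectedComponentMk i))
    exact Finset.mem_product.2 ⟨(hS₁ _ _).1 hi.1 ⟨i, rfl⟩, (hS₂ _ _).1 hi.2 ⟨i, rfl⟩⟩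
  · intro z _ z' _ h
    funext K
    obtain ⟨i, rfl⟩ := K.exists_rep
    exact add_left_cancel (congrFun h i)
  · intro y hy
    rw [Finset.mem_filter, Fintype.mem_piFinset, subset_attackEdges_iff] at hy
    obtain ⟨hbox, hy⟩ := hy
    -- The translation of a component can be read off at an arbitrary vertex of it.
    have key : ∀ i, G.position i +
        (y (G.toSimpleGraph.connectedComponentMk i).nonempty_supp.some -
          G.position (G.toSimpleGraph.connectedComponentMk i).nonempty_supp.some) = y i := by
      intro i
      rw [hy _ i (G.toSimpleGraph.connectedComponentMk i).nonempty_supp.some_mem]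
      abel
    refine ⟨fun K => y K.nonempty_supp.some - G.position K.nonempty_supp.some, ?_, ?_⟩
    · refine Fintype.mem_piFinset.2 fun K => Finset.mem_product.2
        ⟨(hS₁ _ _).2 ?_, (hS₂ _ _).2 ?_⟩
      · rintro ⟨i, rfl⟩
        have := (Finset.mem_product.1 (hbox i)).1
        rwa [← key i] at this
      · rintro ⟨i, rfl⟩
        have := (Finset.mem_product.1 (hbox i)).2
        rwa [← key i] at this
    · funext i
      exact key i

theorem size_eq_sum : G.size = ∑ K : G.Component, Nat.card K.supp := by
  classical
  have h := Finset.card_eq_sum_card_fiberwise (s := (Finset.univ : Finset (Fin G.size)))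
    (t := (Finset.univ : Finset G.Component)) (f := G.toSimpleGraph.connectedComponentMk)
    (fun _ _ => Finset.mem_coe.2 (Finset.mem_univ _))
  rw [Finset.card_univ, Fintype.card_fin] at h
  refine h.trans (Finset.sum_congr rfl fun K _ => ?_)
  rw [Nat.card_eq_fintype_card, Fintype.card_subtype]
  simp only [SimpleGraph.ConnectedComponent.mem_supp_iff]

theorem two_le_card_supp (K : G.Component) : 2 ≤ Nat.card K.supp := by
  obtain ⟨i, rfl⟩ := K.exists_rep
  obtain ⟨j, m, h⟩ := G.no_isolated i
  have hadj : G.toSimpleGraph.Adj i j := G.adj_iff.2 ⟨m, h⟩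
  rw [Nat.card_coe_set_eq]
  refine (Set.one_lt_ncard (Set.toFinite _)).2 ⟨i, rfl, j, ?_, hadj.ne⟩
  exact SimpleGraph.ConnectedComponent.sound hadj.symm.reachable

theorem two_mul_numComponents_le : 2 * G.numComponents ≤ G.size := by
  rw [size_eq_sum, numComponents, mul_comm, ← Finset.card_univ, ← smul_eq_mul]
  exact Finset.card_nsmul_le_sum _ _ _ fun K _ => G.two_le_card_supp K

/-- From `2c ≤ k` follows `k ≤ 2(k - c)`. This makes the cruxes of a given codegree finite in
number. -/
theorem size_le_codegree : G.size ≤ G.codegree := by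
  have := G.two_mul_numComponents_le
  rw [codegree]
  omega

/-- Each of the other `c - 1` components contributes at least one vertex. -/
theorem card_supp_add_le (K : G.Component) :
    Nat.card K.supp + G.numComponents ≤ G.size + 1 := by
  classical
  have h := G.size_eq_sum
  rw [← Finset.add_sum_erase _ _ (Finset.mem_univ K)] at h
  have h2 : (Finset.univ.erase K).card * 1 ≤ ∑ K' ∈ Finset.univ.erase K, Nat.card K'.supp := by
    rw [← smul_eq_mul]
    exact Finset.card_nsmul_le_sum _ _ _ fun K' _ => by
      have := G.two_le_card_supp K'
      omega
  rw [Finset.card_erase_of_mem (Finset.mem_univ _), Finset.card_univ] at h2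
  rw [numComponents]
  omega

theorem natAbs_position_sub_le {i j : Fin G.size} (p : G.toSimpleGraph.Walk i j) :
    ((G.position i).1 - (G.position j).1).natAbs ≤ maxCoord M * p.length ∧
      ((G.position i).2 - (G.position j).2).natAbs ≤ maxCoord M * p.length := by
  induction p with
  | nil => simp
  | @cons u v w hadj p ih =>
    have hstep : ((G.position u).1 - (G.position v).1).natAbs ≤ maxCoord M ∧
        ((G.position u).2 - (G.position v).2).natAbs ≤ maxCoord M := by
      obtain ⟨m, hm | hm⟩ := G.adj_iff.1 hadj <;>
      · rw [← attackEdges_position] at hm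
        obtain ⟨hm, -, rfl⟩ := mem_attackEdges.1 hm
        have := natAbs_le_maxCoord hm
        simp only [Prod.fst_sub, Prod.snd_sub] at this
        omega
    rw [SimpleGraph.Walk.length_cons, mul_add, mul_one]
    omega

/-- The vertices of a path are distinct and stay in `K`, so its length is at most `|K| - 1 ≤ k - c`.
-/
theorem exists_walk_length_le {K : G.Component} (i j : K.supp) :
    ∃ p : G.toSimpleGraph.Walk i j, 2 * p.length ≤ G.codegree := by
  classical
  have hij : G.toSimpleGraph.connectedComponentMk i = G.toSimpleGraph.connectedComponentMk j :=
    i.2.trans j.2.symm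
  obtain ⟨p, hp⟩ := (SimpleGraph.ConnectedComponent.eq.1 hij).exists_isPath
  refine ⟨p, ?_⟩
  have h1 : p.length + 1 ≤ Nat.card K.supp := by
    rw [← SimpleGraph.Walk.length_support, ← List.toFinset_card_of_nodup hp.support_nodup,
      Nat.card_coe_set_eq, ← Set.ncard_coe_finset]
    refine Set.ncard_le_ncard (fun v hv => ?_) (Set.toFinite _)
    have hv' : v ∈ p.support := by simpa using hv
    exact (SimpleGraph.ConnectedComponent.sound (p.takeUntil v hv').reachable).symm.trans i.2
  have h2 := G.card_supp_add_le K
  rw [codegree]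
  omega

theorem two_mul_extents_le (i : G.Component ⊕ G.Component) :
    2 * G.extents i ≤ maxCoord M * G.codegree := by
  suffices h : G.extents i ≤ maxCoord M * (G.size - G.numComponents) by
    rw [codegree, mul_left_comm]
    omega
  rcases i with K | K <;> refine Finset.sup_le fun p _ => ?_ <;>
  · obtain ⟨w, hw⟩ := G.exists_walk_length_le p.1 p.2
    have h := G.natAbs_position_sub_le w
    have h2 : maxCoord M * w.length ≤ maxCoord M * (G.size - G.numComponents) := by
      rw [codegree] at hw
      gcongr
      omega
    omega

end Crux

/-! ### Isomorphism types of cruxes -/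

namespace Crux

variable {M : Finset (ℤ × ℤ)} {G H K : Crux M}

theorem Iso.refl (G : Crux M) : G.Iso G := ⟨Equiv.refl _, fun _ _ _ => Iff.rfl⟩

theorem Iso.symm (h : G.Iso H) : H.Iso G := by
  obtain ⟨σ, hσ⟩ := h
  exact ⟨σ.symm, fun i j m => by simp [hσ]⟩

theorem Iso.trans (h : G.Iso H) (h' : H.Iso K) : G.Iso K := by
  obtain ⟨σ, hσ⟩ := h
  obtain ⟨τ, hτ⟩ := h'
  exact ⟨σ.trans τ, fun i j m => by simp [hσ, hτ]⟩

theorem Iso.codegree_eq (h : G.Iso H) : G.codegree = H.codegree := by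
  obtain ⟨σ, hσ⟩ := h
  have hsize : G.size = H.size := by simpa using Fintype.card_congr σ
  let e : G.toSimpleGraph ≃g H.toSimpleGraph :=
    ⟨σ, fun {i j} => by simp only [adj_iff, hσ]⟩
  have hcomp : G.numComponents = H.numComponents := Fintype.card_congr e.connectedComponentEquiv
  rw [codegree, codegree, hsize, hcomp]

theorem even_codegree (G : Crux M) : Even G.codegree := even_two_mul _

theorem finite_codegree_eq (M : Finset (ℤ × ℤ)) (r : ℕ) :
    Finite {G : Crux M // G.codegree = r} := by
  have := attackGraph_finite M
  refine Finite.of_injective (β := Σ k : Fin (r + 1), AttackGraph M k)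
    (fun G => ⟨⟨G.1.size, Nat.lt_succ_of_le (G.1.size_le_codegree.trans G.2.le)⟩, G.1.graph⟩) ?_
  rintro ⟨⟨k, A, hA⟩, hG⟩ ⟨⟨l, B, hB⟩, hH⟩ h
  simp only [Sigma.mk.injEq, Fin.mk.injEq] at h
  obtain ⟨rfl, h⟩ := h
  obtain rfl := eq_of_heq h
  rfl

/-- Isomorphism of cruxes of a given codegree. -/
def isoSetoid (M : Finset (ℤ × ℤ)) (r : ℕ) : Setoid {G : Crux M // G.codegree = r} where
  r G H := G.1.Iso H.1
  iseqv := ⟨fun G => Iso.refl G.1, Iso.symm, Iso.trans⟩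

/-- There is a finite system of representatives of the cruxes of codegree `r`. -/
theorem exists_representatives (M : Finset (ℤ × ℤ)) (r : ℕ) :
    ∃ (m : ℕ) (T : Fin m → Crux M), (∀ t, (T t).codegree = r) ∧
      ∀ G : Crux M, G.codegree = r → ∃! t, G.Iso (T t) := by
  have := finite_codegree_eq M r
  let e := Finite.equivFin (Quotient (isoSetoid M r))
  refine ⟨_, fun t => (Quotient.out (e.symm t)).1, fun t => (Quotient.out (e.symm t)).2, ?_⟩
  intro G hG
  have key : ∀ t, G.Iso (Quotient.out (e.symm t)).1 ↔
      t = e (Quotient.mk (isoSetoid M r) ⟨G, hG⟩) := by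
    intro t
    -- The class of the chosen representative is `e.symm t`, so equality of classes becomes
    -- isomorphism.
    rw [← Equiv.symm_apply_eq, eq_comm, ← Quotient.out_eq (e.symm t), Quotient.eq,
      Quotient.out_eq]
    rfl
  exact ⟨_, (key _).2 rfl, fun t ht => (key t).1 ht⟩

/-! ### Copies of a crux among the attack graphs on `q` pieces -/

theorem exists_map_eq {q : ℕ} (A : AttackGraph M q) :
    ∃ (G : Crux M) (ε : Fin G.size ↪ Fin q), G.graph.map ε = A := by
  classical
  -- The crux of `A` lives on its non-isolated vertices, enumerated in increasing order.
  set V : Finset (Fin q) := Finset.univ.filter fun i => ∃ j m, (i, j, m) ∈ A.1 ∨ (j, i, m) ∈ A.1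
    with hV
  set ε : Fin V.card ↪ Fin q := (V.orderEmbOfFin rfl).toEmbedding with hε
  have hrange : ∀ i, i ∈ Set.range ε ↔ ∃ j m, (i, j, m) ∈ A.1 ∨ (j, i, m) ∈ A.1 := by
    intro i
    have : Set.range ε = V := Finset.range_orderEmbOfFin V rfl
    rw [this, hV]
    simp
  refine ⟨⟨V.card, A.comap ε, fun i => ?_⟩, ε, AttackGraph.map_comap ?_⟩
  · obtain ⟨j, m, h⟩ := (hrange (ε i)).1 ⟨i, rfl⟩
    have hj : j ∈ Set.range ε := (hrange j).2 ⟨ε i, m, h.symm⟩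
    obtain ⟨j, rfl⟩ := hj
    exact ⟨j, m, h.imp AttackGraph.mem_comap.2 AttackGraph.mem_comap.2⟩
  · rintro ⟨i, j, m⟩ he
    obtain ⟨i, rfl⟩ := (hrange i).2 ⟨j, m, .inl he⟩
    obtain ⟨j, rfl⟩ := (hrange j).2 ⟨_, m, .inr he⟩
    exact ⟨(i, j, m), rfl⟩

/-- Since a crux has no isolated vertices, its image determines the range of the injection. -/
theorem mem_range_iff {q : ℕ} (ε : Fin G.size ↪ Fin q) (i : Fin q) :
    i ∈ Set.range ε ↔ ∃ j m, (i, j, m) ∈ (G.graph.map ε).1 ∨ (j, i, m) ∈ (G.graph.map ε).1 := by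
  constructor
  · rintro ⟨i, rfl⟩
    obtain ⟨j, m, h⟩ := G.no_isolated i
    exact ⟨ε j, m, h.imp AttackGraph.apply_mem_map.2 AttackGraph.apply_mem_map.2⟩
  · rintro ⟨j, m, h | h⟩ <;>
    · obtain ⟨e, -, he⟩ := AttackGraph.mem_map.1 h
      simp only [edgeEmbedding_apply, Prod.mk.injEq] at he
      first
      | exact ⟨_, he.1⟩
      | exact ⟨_, he.2.1⟩

/-- Two copies of cruxes with the same image differ by an isomorphism. -/
theorem exists_equiv_of_map_eq {q : ℕ} {ε : Fin G.size ↪ Fin q} {δ : Fin H.size ↪ Fin q}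
    (h : G.graph.map ε = H.graph.map δ) :
    ∃ σ : Fin G.size ≃ Fin H.size, (∀ i, δ (σ i) = ε i) ∧
      ∀ i j m, (i, j, m) ∈ G.graph.1 ↔ (σ i, σ j, m) ∈ H.graph.1 := by
  have hrange : ∀ i, i ∈ Set.range ε ↔ i ∈ Set.range δ := fun i => by
    rw [mem_range_iff, mem_range_iff, h]
  choose f hf using fun i => (hrange (ε i)).1 ⟨i, rfl⟩
  choose g hg using fun i => (hrange (δ i)).2 ⟨i, rfl⟩
  refine ⟨⟨f, g, fun i => ε.injective (by rw [hg, hf]), fun i => δ.injective (by rw [hf, hg])⟩,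
    hf, fun i j m => ?_⟩
  rw [← AttackGraph.apply_mem_map (ε := ε), h, ← hf, ← hf, AttackGraph.apply_mem_map]
  rfl

theorem map_trans_eq {q : ℕ} {δ : Fin H.size ↪ Fin q} (σ : Fin G.size ≃ Fin H.size)
    (hσ : ∀ i j m, (i, j, m) ∈ G.graph.1 ↔ (σ i, σ j, m) ∈ H.graph.1) :
    G.graph.map (σ.toEmbedding.trans δ) = H.graph.map δ := by
  apply Subtype.ext
  ext e
  rw [AttackGraph.mem_map, AttackGraph.mem_map]
  constructor
  · rintro ⟨⟨i, j, m⟩, he, rfl⟩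
    exact ⟨_, (hσ i j m).1 he, rfl⟩
  · rintro ⟨⟨i, j, m⟩, he, rfl⟩
    refine ⟨(σ.symm i, σ.symm j, m), (hσ _ _ _).2 (by simpa using he), by simp⟩

theorem exists_map_eq_iff_iso {q : ℕ} {ε : Fin G.size ↪ Fin q} :
    (∃ δ : Fin H.size ↪ Fin q, H.graph.map δ = G.graph.map ε) ↔ G.Iso H := by
  constructor
  · rintro ⟨δ, hδ⟩
    obtain ⟨σ, -, hσ⟩ := exists_equiv_of_map_eq hδ.symm
    exact ⟨σ, hσ⟩
  · intro h
    obtain ⟨σ, hσ⟩ := h.symm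
    exact ⟨σ.toEmbedding.trans ε, map_trans_eq σ hσ⟩

/-- Each copy of a crux is the image of exactly `|Aut G|` injections. -/
theorem card_filter_map_eq {q : ℕ} (ε : Fin G.size ↪ Fin q) [DecidableEq (AttackGraph M q)] :
    (Finset.univ.filter fun δ : Fin G.size ↪ Fin q =>
      G.graph.map δ = G.graph.map ε).card = G.autCard := by
  rw [← Fintype.card_subtype, ← Nat.card_eq_fintype_card, autCard]
  symm
  refine Nat.card_congr (Equiv.ofBijective
    (fun σ => ⟨σ.1.toEmbedding.trans ε, map_trans_eq σ.1 σ.2⟩) ⟨?_, ?_⟩)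
  · rintro ⟨σ, hσ⟩ ⟨τ, hτ⟩ h
    rw [Subtype.mk.injEq] at h ⊢
    exact Equiv.ext fun i => ε.injective (DFunLike.congr_fun h i)
  · rintro ⟨δ, hδ⟩
    obtain ⟨σ, hσ, hσ'⟩ := exists_equiv_of_map_eq hδ
    exact ⟨⟨σ, hσ'⟩, Subtype.ext (DFunLike.ext _ _ hσ)⟩

theorem autCard_pos (G : Crux M) : 0 < G.autCard := by
  have : Nonempty {σ : Equiv.Perm (Fin G.size) //
    ∀ i j m, (i, j, m) ∈ G.graph.1 ↔ (σ i, σ j, m) ∈ G.graph.1} :=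
    ⟨⟨Equiv.refl _, fun _ _ _ => Iff.rfl⟩⟩
  exact Nat.card_pos

theorem numComponents_le_size (G : Crux M) : G.numComponents ≤ G.size := by
  have := G.two_mul_numComponents_le
  omega

theorem coeff_eq_zero_of_lt (G : Crux M) {q : ℕ} (h : q < G.size) : G.coeff q = 0 := by
  rw [coeff, Nat.descFactorial_of_lt h]
  simp

/-- The term of `G` collects the contributions of all its copies. -/
theorem term_eq_sum (G : Crux M) (q n : ℕ) [Fintype (AttackGraph M q)]
    [∀ A : AttackGraph M q, Decidable (∃ ε : Fin G.size ↪ Fin q, G.graph.map ε = A)] :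
    G.term q n = ∑ A : AttackGraph M q,
      if ∃ ε : Fin G.size ↪ Fin q, G.graph.map ε = A then
        ((A.mobius * A.superCount n : ℤ) : ℚ) else 0 := by
  classical
  -- The contribution shared by all copies of `G`.
  set c : ℚ := G.graph.mobius * (truncatedProd G.extents n * n ^ (2 * (q - G.size))) with hc
  have hval : ∀ ε : Fin G.size ↪ Fin q,
      (((G.graph.map ε).mobius * (G.graph.map ε).superCount n : ℤ) : ℚ) = c := by
    intro ε
    rw [AttackGraph.mobius_map, AttackGraph.superCount_map, superCount_eq, hc,
      truncatedProd_eq_prod_sub]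
    push_cast
    rfl
  have hterm : G.term q n = c * q.descFactorial G.size / G.autCard := by
    rcases lt_or_ge q G.size with h | h
    · rw [term, coeff_eq_zero_of_lt G h, Nat.descFactorial_of_lt h]
      simp
    · have hexp : 2 * q - 2 * G.numComponents - G.codegree = 2 * (q - G.size) := by
        have := G.numComponents_le_size
        rw [codegree]
        omega
      rw [term, coeff, hexp, hc]
      ring
  have haut : (G.autCard : ℚ) ≠ 0 := Nat.cast_ne_zero.2 G.autCard_pos.ne'
  rw [hterm, div_eq_iff haut, Finset.sum_mul]
  have hcount : c * q.descFactorial G.size = ∑ ε : Fin G.size ↪ Fin q, c := by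
    rw [Finset.sum_const, Finset.card_univ, Fintype.card_embedding_eq, Fintype.card_fin,
      Fintype.card_fin, nsmul_eq_mul, mul_comm]
  -- Injections are grouped by the copy they produce; every nonempty group has `|Aut G|` elements.
  rw [hcount, ← Finset.sum_fiberwise_of_maps_to (t := Finset.univ)
    (g := fun ε => G.graph.map ε) (fun _ _ => Finset.mem_univ _)]
  refine Finset.sum_congr rfl fun A _ => ?_
  split_ifs with h
  · obtain ⟨ε, rfl⟩ := h
    rw [Finset.sum_const, card_filter_map_eq, hval, nsmul_eq_mul, mul_comm]
  · rw [zero_mul, Finset.sum_eq_zero]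
    intro ε hε
    exact absurd ⟨ε, (Finset.mem_filter.1 hε).2⟩ h

end Crux

/-! ### Assembling the formula -/

/-- The formula for the nonattacking count in terms of representatives of the cruxes. -/
theorem nonattackingCount_eq_sum_term {M : Finset (ℤ × ℤ)} {m : ℕ → ℕ}
    {T : (r : ℕ) → Fin (m r) → Crux M} (hT : ∀ r t, (T r t).codegree = r)
    (huniq : ∀ G : Crux M, ∃! t, G.Iso (T G.codegree t)) {q R : ℕ} (n : ℕ) (hR : 2 * q ≤ R) :
    (nonattackingCount M q n : ℚ) = (n : ℚ) ^ (2 * q) +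
      ∑ r ∈ (Finset.Icc 2 R).filter (fun r => Even r), ∑ t, (T r t).term q n := by
  classical
  have := attackGraph_finite M q
  have := Fintype.ofFinite (AttackGraph M q)
  simp only [Crux.term_eq_sum]
  simp only [Finset.sum_comm (t := (Finset.univ : Finset (AttackGraph M q)))]
  have hempty : ((AttackGraph.empty M q).superCount n : ℚ) = (n : ℚ) ^ (2 * q) := by
    have h : ∀ x : Fin q → ℤ × ℤ, (AttackGraph.empty M q).1 ⊆ attackEdges M x := fun x =>
      Finset.empty_subset _
    rw [AttackGraph.superCount, Finset.filter_true_of_mem fun x _ => h x, Fintype.card_piFinset]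
    simp [pow_mul, sq]
  have hcount : (nonattackingCount M q n : ℚ) =
      ∑ A : AttackGraph M q, ((A.mobius * A.superCount n : ℤ) : ℚ) := by
    rw [← Int.cast_sum, ← nonattackingCount_eq_sum_mobius, Int.cast_natCast]
  rw [hcount, ← Finset.add_sum_erase _ _ (Finset.mem_univ (AttackGraph.empty M q)),
    ← Finset.add_sum_erase Finset.univ (fun A => ∑ r ∈ _, _) (Finset.mem_univ (AttackGraph.empty M q))]
  -- The empty graph supplies `n ^ (2 * q)`. It is no copy of a crux of codegree at least 2, since
  -- such a crux has a vertex and hence an edge.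
  rw [Finset.sum_eq_zero (s := (Finset.Icc 2 R).filter fun r => Even r), zero_add,
    AttackGraph.mobius_empty, one_mul, Int.cast_natCast, hempty]
  · congr 1
    refine Finset.sum_congr rfl fun A hA => ?_
    obtain ⟨G, ε, rfl⟩ := Crux.exists_map_eq A
    simp only [Crux.exists_map_eq_iff_iso]
    have hne := (Finset.mem_erase.1 hA).1
    have hpos : 0 < G.size := by
      by_contra h0
      refine hne (Subtype.ext (Finset.eq_empty_of_forall_notMem fun e he => ?_))
      obtain ⟨e', -, -⟩ := AttackGraph.mem_map.1 he
      exact h0 e'.1.pos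
    have hle : G.size ≤ q := by simpa using Fintype.card_le_of_embedding ε
    have hmem : G.codegree ∈ (Finset.Icc 2 R).filter fun r => Even r := by
      have h1 := G.two_mul_numComponents_le
      have h2 := G.size_le_codegree
      refine Finset.mem_filter.2 ⟨Finset.mem_Icc.2 ?_, G.even_codegree⟩
      rw [Crux.codegree] at h2 ⊢
      omega
    -- A nonempty graph is counted once: for the codegree of its crux and the unique isomorphic
    -- representative.
    rw [Finset.sum_eq_single_of_mem _ hmem]
    · obtain ⟨t, ht, ht'⟩ := huniq G
      rw [Finset.sum_eq_single_of_mem t (Finset.mem_univ _), if_pos ht]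
      intro s _ hs
      exact if_neg fun h => hs (ht' s h)
    · intro r _ hr
      refine Finset.sum_eq_zero fun t _ => if_neg fun h => hr ?_
      rw [h.codegree_eq, hT]
  · intro r hr
    refine Finset.sum_eq_zero fun t _ => if_neg ?_
    rintro ⟨ε, hε⟩
    have h2 := (Finset.mem_Icc.1 (Finset.mem_filter.1 hr).1).1
    have hsize : 0 < (T r t).size := by
      have h3 := hT r t
      rw [Crux.codegree] at h3
      omega
    obtain ⟨j, k, h⟩ := (Crux.mem_range_iff ε (ε ⟨0, hsize⟩)).1 ⟨_, rfl⟩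
    rw [hε] at h
    exact h.elim (Finset.notMem_empty _) (Finset.notMem_empty _)

/-! ### Codegree coefficients -/

theorem codegreeCoeff_sum {ι : Type*} (s : Finset ι) (p : ι → ℚ[X]) (d r : ℕ) :
    codegreeCoeff d r (∑ i ∈ s, p i) = ∑ i ∈ s, codegreeCoeff d r (p i) := by
  unfold codegreeCoeff
  split_ifs <;> simp

theorem codegreeCoeff_add (p p' : ℚ[X]) (d r : ℕ) :
    codegreeCoeff d r (p + p') = codegreeCoeff d r p + codegreeCoeff d r p' := by
  unfold codegreeCoeff
  split_ifs <;> simp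

theorem codegreeCoeff_C_mul (a : ℚ) (p : ℚ[X]) (d r : ℕ) :
    codegreeCoeff d r (C a * p) = a * codegreeCoeff d r p := by
  unfold codegreeCoeff
  split_ifs <;> simp

theorem codegreeCoeff_X_pow_mul (p : ℚ[X]) (a d r : ℕ) :
    codegreeCoeff (a + d) r (X ^ a * p) = codegreeCoeff d r p := by
  unfold codegreeCoeff
  rw [coeff_X_pow_mul']
  rcases le_or_gt r d with h | h
  · rw [if_pos (by omega), if_pos (by omega), if_pos h]
    congr 1
    omega
  · rw [if_neg (by omega : ¬ r ≤ d)]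
    split_ifs
    · omega
    · rfl
    · rfl

theorem codegreeCoeff_X_pow (d r : ℕ) :
    codegreeCoeff d r (X ^ d) = if r = 0 then 1 else 0 := by
  have h := codegreeCoeff_X_pow_mul 1 d 0 r
  rw [mul_one, add_zero] at h
  rw [h]
  unfold codegreeCoeff
  rcases Nat.eq_zero_or_pos r with rfl | h
  · simp
  · rw [if_neg (by omega), if_neg (by omega)]

/-- Codegrees with respect to a larger degree are shifted. -/
theorem codegreeCoeff_add_left {p : ℚ[X]} {d : ℕ} (hp : p.degree ≤ d) (r s : ℕ) :
    codegreeCoeff (d + r) s p = if r ≤ s then codegreeCoeff d (s - r) p else 0 := by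
  unfold codegreeCoeff
  rcases le_or_gt r s with h | h
  · rw [if_pos h]
    simp only [Nat.sub_le_iff_le_add]
    split_ifs
    · congr 1
      omega
    · rfl
  · rw [if_pos (by omega : s ≤ d + r), if_neg (not_le.2 h)]
    have hlt : d < d + r - s := by omega
    exact coeff_eq_zero_of_degree_lt (hp.trans_lt (by exact_mod_cast hlt))

theorem eval_linear (q r d : ℕ) :
    (C 2 * X - C (r : ℚ)).eval (q : ℚ) = (d : ℚ) ↔ 2 * q = d + r := by
  simp only [eval_sub, eval_mul, eval_C, eval_X, sub_eq_iff_eq_add]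
  norm_cast

theorem eval_linear_neg (q r : ℕ) :
    (C 2 * X - C (r : ℚ)).eval (q : ℚ) < 0 ↔ 2 * q < r := by
  simp only [eval_sub, eval_mul, eval_C, eval_X, sub_neg]
  norm_cast

theorem isNumericalPolynomial_linear (r : ℕ) :
    IsNumericalPolynomial (C 2 * X - C (r : ℚ)) := fun z => ⟨2 * z - r, by simp⟩

theorem isEventuallyNonneg_linear (r : ℕ) : IsEventuallyNonneg (C 2 * X - C (r : ℚ)) := by
  filter_upwards [Filter.eventually_ge_atTop r] with q hq
  by_contra! h
  rw [eval_linear_neg] at h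
  omega

/-! ### The polynomial of a single crux -/

namespace Crux

variable {M : Finset (ℤ × ℤ)} (G : Crux M)

/-- The polynomial `∏ (n - aᵢ)` in the extents of `G`. -/
noncomputable def extentsPoly : ℚ[X] := ∏ i, (X - C ((G.extents i : ℕ) : ℚ))

theorem extentsPoly_monic : G.extentsPoly.Monic := monic_prod_X_sub_C _ _

theorem natDegree_extentsPoly : G.extentsPoly.natDegree = 2 * G.numComponents := by
  rw [extentsPoly, natDegree_prod_of_monic _ _ fun i _ => monic_X_sub_C _]
  simp only [natDegree_X_sub_C, Finset.sum_const, Finset.card_univ, Fintype.card_sum, smul_eq_mul,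
    mul_one, numComponents, two_mul]

theorem codegree_add_eq : G.codegree + 2 * G.numComponents = 2 * G.size := by
  have := G.numComponents_le_size
  rw [codegree]
  omega

theorem termPoly_eq {q : ℕ} (hq : G.size ≤ q) :
    G.termPoly q = C (G.coeff q) * (X ^ (2 * (q - G.size)) * G.extentsPoly) := by
  have hexp : 2 * q - 2 * G.numComponents - G.codegree = 2 * (q - G.size) := by
    have := G.codegree_add_eq
    omega
  rw [termPoly, hexp, mul_assoc, extentsPoly]

theorem termPoly_eq_zero_of_lt {q : ℕ} (hq : q < G.size) : G.termPoly q = 0 := by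
  rw [termPoly, coeff_eq_zero_of_lt G hq]
  simp

theorem termPoly_eq_zero_of_lt_codegree {q : ℕ} (hq : 2 * q < G.codegree) :
    G.termPoly q = 0 := by
  refine G.termPoly_eq_zero_of_lt ?_
  have := G.codegree_add_eq
  omega

theorem degree_termPoly {q : ℕ} (hq : G.coeff q ≠ 0) :
    (G.termPoly q).degree = ((2 * q - G.codegree : ℕ) : WithBot ℕ) := by
  have hle : G.size ≤ q := by
    by_contra! h
    exact hq (coeff_eq_zero_of_lt G h)
  have hm : (X ^ (2 * (q - G.size)) * G.extentsPoly).Monic :=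
    (monic_X_pow _).mul G.extentsPoly_monic
  rw [G.termPoly_eq hle, degree_C_mul hq, degree_eq_natDegree hm.ne_zero,
    (monic_X_pow _).natDegree_mul G.extentsPoly_monic, natDegree_X_pow, natDegree_extentsPoly]
  congr 1
  have := G.codegree_add_eq
  omega

theorem termPoly_eq_zero_or_degree (q : ℕ) :
    G.termPoly q = 0 ∨ (G.termPoly q).degree = ((2 * q - G.codegree : ℕ) : WithBot ℕ) := by
  by_cases h : G.coeff q = 0
  · left
    rw [termPoly, h]
    simp
  · exact .inr (G.degree_termPoly h)

theorem degree_termPoly_le (q : ℕ) :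
    (G.termPoly q).degree ≤ ((2 * q - G.codegree : ℕ) : WithBot ℕ) := by
  rcases G.termPoly_eq_zero_or_degree q with h | h
  · simp [h]
  · exact h.le

theorem coeff_ne_zero {q : ℕ} (hμ : G.graph.mobius ≠ 0) (hq : G.size ≤ q) : G.coeff q ≠ 0 := by
  have h1 : q.descFactorial G.size ≠ 0 := by
    rw [Ne, Nat.descFactorial_eq_zero_iff_lt]
    omega
  rw [coeff]
  exact div_ne_zero (mul_ne_zero (Int.cast_ne_zero.2 hμ) (Nat.cast_ne_zero.2 h1))
    (Nat.cast_ne_zero.2 G.autCard_pos.ne')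

/-- The polynomial in `q` giving the codegree `s` coefficient of the term of `G`. -/
noncomputable def coeffPoly (s : ℕ) : ℚ[X] :=
  C ((G.graph.mobius : ℚ) / G.autCard * codegreeCoeff (2 * G.numComponents) s G.extentsPoly) *
    descPochhammer ℚ G.size

theorem eval_coeffPoly (s q : ℕ) :
    (G.coeffPoly s).eval (q : ℚ) =
      G.coeff q * codegreeCoeff (2 * G.numComponents) s G.extentsPoly := by
  rw [coeffPoly, eval_mul, eval_C, descPochhammer_eval_eq_descFactorial, coeff]
  ring

theorem eval_coeffPoly_eq_zero (s : ℕ) {q : ℕ} (hq : 2 * q < G.codegree) :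
    (G.coeffPoly s).eval (q : ℚ) = 0 := by
  have := G.codegree_add_eq
  rw [eval_coeffPoly, coeff_eq_zero_of_lt G (by omega), zero_mul]

/-- The power of `X` does not change codegrees, so the coefficient depends on `q` only through
`(q)_k`; for `q < k` both sides vanish. -/
theorem codegreeCoeff_termPoly {q d : ℕ} (h : 2 * q = d + G.codegree) (s : ℕ) :
    codegreeCoeff d s (G.termPoly q) = (G.coeffPoly s).eval (q : ℚ) := by
  rw [eval_coeffPoly]
  rcases lt_or_ge q G.size with hq | hq
  · rw [G.termPoly_eq_zero_of_lt hq, coeff_eq_zero_of_lt G hq, zero_mul]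
    simp [codegreeCoeff]
  · have hd : d = 2 * (q - G.size) + 2 * G.numComponents := by
      have := G.codegree_add_eq
      omega
    rw [G.termPoly_eq hq, codegreeCoeff_C_mul, hd,
      codegreeCoeff_X_pow_mul]

theorem isTwoLevelPolynomial_termPoly :
    IsTwoLevelPolynomial (C 2 * X - C (G.codegree : ℚ)) (fun _ => ⊤) G.termPoly where
  numerical := isNumericalPolynomial_linear _
  eventuallyNonneg := isEventuallyNonneg_linear _
  degree_eq q d h := by
    rw [eval_linear] at h
    obtain rfl : d = 2 * q - G.codegree := by omega
    exact G.termPoly_eq_zero_or_degree q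
  eq_zero q h := G.termPoly_eq_zero_of_lt_codegree ((eval_linear_neg _ _).1 h)
  coefficients := ⟨G.coeffPoly, fun _ _ s h _ =>
    G.codegreeCoeff_termPoly ((eval_linear _ _ _).1 h) s⟩

theorem term_eq_eval {q n : ℕ} (h : maxCoord M * G.codegree ≤ 2 * n) :
    G.term q n = (G.termPoly q).eval (n : ℚ) := by
  rw [term, termPoly, truncatedProd, if_pos]
  · simp [eval_prod]
  · intro i
    have := G.two_mul_extents_le i
    omega

end Crux

/-! ### The whole count as a polynomial -/

/-- The nonattacking count is eventually a polynomial of degree `2q`, whose coefficients are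
polynomials in `q`. -/
theorem isEventualTwoLevelPolynomial_nonattackingCount {M : Finset (ℤ × ℤ)} {m : ℕ → ℕ}
    {T : (r : ℕ) → Fin (m r) → Crux M} (hT : ∀ r t, (T r t).codegree = r)
    (huniq : ∀ G : Crux M, ∃! t, G.Iso (T G.codegree t)) :
    IsEventualTwoLevelPolynomial (C 2 * X) (fun _ => ⊤)
      (fun q n => (nonattackingCount M q n : ℚ)) := by
  have hg : (C 2 * X : ℚ[X]) = C 2 * X - C ((0 : ℕ) : ℚ) := by simp
  have hd : ∀ q r t, ((T r t).termPoly q).degree ≤ ((2 * q - r : ℕ) : WithBot ℕ) := fun q r t => by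
    have := (T r t).degree_termPoly_le q
    rwa [hT] at this
  rw [hg]
  refine ⟨isNumericalPolynomial_linear _, isEventuallyNonneg_linear _, fun q h => ?_,
    fun q => X ^ (2 * q) +
      ∑ r ∈ (Finset.Icc 2 (2 * q)).filter (fun r => Even r), ∑ t, (T r t).termPoly q, ?_, ?_⟩
  · rw [eval_linear_neg] at h
    omega
  · intro q d h
    rw [eval_linear] at h
    obtain rfl : d = 2 * q := by omega
    constructor
    · rw [degree_add_eq_left_of_degree_lt, degree_X_pow]
      rw [degree_X_pow]
      refine (degree_sum_le _ _).trans_lt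
        ((Finset.sup_lt_iff (WithBot.bot_lt_coe _)).2 fun r hr => ?_)
      have hr := Finset.mem_Icc.1 (Finset.mem_filter.1 hr).1
      refine (degree_sum_le _ _).trans_lt
        ((Finset.sup_lt_iff (WithBot.bot_lt_coe _)).2 fun t _ => ?_)
      refine (hd q r t).trans_lt ?_
      exact_mod_cast (by omega : 2 * q - r < 2 * q)
    -- All occurring `r` are at most `2q`, so `n ≥ wq` satisfies every bound `n ≥ wr/2` at once.
    · filter_upwards [Filter.eventually_ge_atTop (maxCoord M * q)] with n hn
      rw [nonattackingCount_eq_sum_term hT huniq n le_rfl, eval_add, eval_finsetSum, eval_pow,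
        eval_X]
      congr 1
      refine Finset.sum_congr rfl fun r hr => ?_
      have hr := Finset.mem_Icc.1 (Finset.mem_filter.1 hr).1
      rw [eval_finsetSum]
      refine Finset.sum_congr rfl fun t _ => (T r t).term_eq_eval ?_
      rw [hT]
      calc maxCoord M * r ≤ maxCoord M * (2 * q) := Nat.mul_le_mul_left _ hr.2
        _ ≤ 2 * n := by rw [mul_left_comm]; omega
  -- The range of `r` must not depend on `q`, hence `r ≤ s` instead of `r ≤ 2q`. A crux of codegree
  -- `r` affects codegree `s` of the count through its own codegree `s - r`.
  · refine ⟨fun s => (if s = 0 then 1 else 0) +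
      ∑ r ∈ (Finset.Icc 2 s).filter (fun r => Even r), ∑ t, (T r t).coeffPoly (s - r), ?_⟩
    intro q d s h _
    rw [eval_linear] at h
    obtain rfl : d = 2 * q := by omega
    rw [codegreeCoeff_add, codegreeCoeff_X_pow, eval_add, codegreeCoeff_sum, eval_finsetSum]
    congr 1
    · split_ifs <;> simp
    · have hterm : ∀ r ∈ (Finset.Icc 2 (2 * q)).filter (fun r => Even r),
          codegreeCoeff (2 * q) s (∑ t, (T r t).termPoly q) =
            if r ≤ s then (∑ t, (T r t).coeffPoly (s - r)).eval (q : ℚ) else 0 := by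
        intro r hr
        have hr := Finset.mem_Icc.1 (Finset.mem_filter.1 hr).1
        have h2q : 2 * q = (2 * q - r) + r := by omega
        rw [codegreeCoeff_sum, eval_finsetSum]
        split_ifs with hrs
        · refine Finset.sum_congr rfl fun t _ => ?_
          nth_rw 1 [h2q]
          rw [codegreeCoeff_add_left (hd q r t), if_pos hrs,
            (T r t).codegreeCoeff_termPoly (by rw [hT]; exact h2q)]
        · refine Finset.sum_eq_zero fun t _ => ?_
          nth_rw 1 [h2q]
          rw [codegreeCoeff_add_left (hd q r t), if_neg hrs]
      rw [Finset.sum_congr rfl hterm, ← Finset.sum_filter]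
      -- The extra indices `2q < r ≤ s` contribute zero, as `q` is then below the size of the crux.
      refine Finset.sum_subset ?_ ?_
      · intro r hr
        simp only [Finset.mem_filter, Finset.mem_Icc] at hr ⊢
        exact ⟨⟨hr.1.1.1, hr.2⟩, hr.1.2⟩
      · intro r hr hr'
        simp only [Finset.mem_filter, Finset.mem_Icc] at hr hr'
        rw [eval_finsetSum]
        refine Finset.sum_eq_zero fun t _ => (T r t).eval_coeffPoly_eq_zero _ ?_
        rw [hT]
        by_contra! hlt
        exact hr' ⟨⟨⟨hr.1.1, hlt⟩, hr.2⟩, hr.1.2⟩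

theorem mainTheorem11 (M : Finset (ℤ × ℤ)) :
    -- the count is an eventual two-level polynomial of degree `2q` and infinite depth
    IsEventualTwoLevelPolynomial (C 2 * X) (fun _ => ⊤)
      (fun q n => (nonattackingCount M q n : ℚ)) ∧
    -- for each codegree there are finitely many types of cruxes, and the formula sums over them
    ∃ (m : ℕ → ℕ) (T : (r : ℕ) → Fin (m r) → Crux M),
      (∀ r, (∀ t, (T r t).codegree = r) ∧
        ∀ G : Crux M, G.codegree = r → ∃! t, G.Iso (T r t)) ∧
      -- the formula; summands with `r > 2q` vanish, so any `R ≥ 2q` gives the full sum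
      (∀ q n R : ℕ, 2 * q ≤ R →
        (nonattackingCount M q n : ℚ) = (n : ℚ) ^ (2 * q) +
          ∑ r ∈ (Finset.Icc 2 R).filter (fun r => Even r), ∑ t, (T r t).term q n) ∧
      -- each term of codegree `r` agrees with a two-level polynomial of degree `2q - r` and
      -- infinite depth for `n ≥ w r / 2`
      (∀ r t,
        (∀ i, 2 * (T r t).extents i ≤ maxCoord M * r) ∧
        IsTwoLevelPolynomial (C 2 * X - C (r : ℚ)) (fun _ => ⊤) (T r t).termPoly ∧
        (∀ q, (T r t).graph.mobius ≠ 0 → (T r t).size ≤ q →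
          ((T r t).termPoly q).degree = ((2 * q - r : ℕ) : WithBot ℕ)) ∧
        ∀ q n : ℕ, maxCoord M * r ≤ 2 * n →
          (T r t).term q n = ((T r t).termPoly q).eval (n : ℚ)) ∧
      -- the same for the sum of all terms of codegree `r`, whose leading terms might cancel
      ∀ r,
        (∀ q, r ≤ 2 * q →
          (∑ t, (T r t).termPoly q).degree ≤ ((2 * q - r : ℕ) : WithBot ℕ)) ∧
        (∀ q, 2 * q < r → ∑ t, (T r t).termPoly q = 0) ∧
        HasTwoLevelCoefficients (C 2 * X - C (r : ℚ)) (fun _ => ⊤)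
          (fun q => ∑ t, (T r t).termPoly q) ∧
        ∀ q n : ℕ, maxCoord M * r ≤ 2 * n →
          ∑ t, (T r t).term q n = (∑ t, (T r t).termPoly q).eval (n : ℚ) := by
  choose m T hT huniq using Crux.exists_representatives M
  refine ⟨isEventualTwoLevelPolynomial_nonattackingCount hT fun G => huniq _ G rfl, m, T,
    fun r => ⟨hT r, huniq r⟩,
    fun q n R hR => nonattackingCount_eq_sum_term hT (fun G => huniq _ G rfl) n hR,
    fun r t => ?_, fun r => ⟨fun q _ => ?_, fun q hq => ?_, ?_, fun q n hn => ?_⟩⟩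
  -- With `T r t` generalized, `r` can be replaced by `G.codegree`.
  · generalize T r t = G, hT r t = hG
    subst hG
    exact ⟨G.two_mul_extents_le, G.isTwoLevelPolynomial_termPoly,
      fun q hμ hq => G.degree_termPoly (G.coeff_ne_zero hμ hq), fun q n hn => G.term_eq_eval hn⟩
  · refine (degree_sum_le _ _).trans (Finset.sup_le fun t _ => ?_)
    have := (T r t).degree_termPoly_le q
    rwa [hT] at this
  · exact Finset.sum_eq_zero fun t _ =>
      (T r t).termPoly_eq_zero_of_lt_codegree (by rwa [hT])
  · refine ⟨fun s => ∑ t, (T r t).coeffPoly s, fun q d s h _ => ?_⟩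
    rw [eval_linear] at h
    rw [codegreeCoeff_sum, eval_finsetSum]
    exact Finset.sum_congr rfl fun t _ =>
      (T r t).codegreeCoeff_termPoly (by rw [hT]; exact h) s
  · rw [eval_finsetSum]
    exact Finset.sum_congr rfl fun t _ => (T r t).term_eq_eval (by rwa [hT])
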